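/- Let $P=\{p_1,\dots,p_n\}\subset\mathbb{R}^d$ be a finite set of $n$ distinct points, let $\mathbf{r}_P(z)=\min_{x\in P}\|x-z\|$, and let $$\mathbf{d}_N(a,b)=4\inf_\gamma\int_0^1 \mathbf{r}_P(\gamma(t))\,\|\gamma'(t)\|\,dt\qquad(a,b\in\mathbb{R}^d),$$ where $\gamma$ ranges over the piecewise-$C^1$ paths $[0,1]\to\mathbb{R}^d$ from $a$ to $b$, be the nearest-neighbor geodesic distance. For $\alpha\ge 0$ the intrinsic Čech complex of $P$ at scale $\alpha$ has as simplices the nonempty subsets $\sigma\subseteq P$ for which the closed balls $\{x\in\mathbb{R}^d: \mathbf{d}_N(p,x)\le\alpha\}$, $p\in\sigma$, have a common point; its edges are the simplices with exactly two vertices. Then the edges of the intrinsic Čech filtration with respect to $\mathbf{d}_N$ can be computed exactly in polynomial time, in the following sense. There are one program for the real RAM and one polynomial $T$ such that for all $d$ and $n$ and every input of $n$ distinct points $p_1,\dots,p_n\in\mathbb{R}^d$, the program halts after at most $T(n+d)$ steps and outputs real numbers $\beta_{ij}$ $(1\le i<j\le n)$ such that for every $\alpha\ge 0$ the edges of the intrinsic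 Čech complex at scale $\alpha$ are exactly the pairs $\{p_i,p_j\}$ with $i<j$ and $\beta_{ij}\le\alpha$. Here the real RAM performs, at unit cost, exact addition, subtraction, multiplication and comparison of real numbers, addition, truncated subtraction and comparison of natural numbers (counters and addresses), indirect array access, and conditional and loop control; programs contain only natural and rational constants, and there is no division, root, floor or rounding. -/

import Mathlib

open scoped Classical

/-! ### The nearest-neighbor geodesic distance -/

namespace NearestNeighbor

/-- `γ` restricted to `[0, 1]` is a piecewise `C¹` path from `a` to `b`: it is continuous, and
`[0, 1]` is cut into finitely many closed intervals, on each of which `γ` is `C¹` (up to the end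
points of the interval). Values of `γ` outside `[0, 1]` are irrelevant. -/
def IsPiecewiseC1Path {d : ℕ} (a b : EuclideanSpace ℝ (Fin d))
    (γ : ℝ → EuclideanSpace ℝ (Fin d)) : Prop :=
  γ 0 = a ∧ γ 1 = b ∧ ContinuousOn γ (Set.Icc 0 1) ∧
    ∃ (m : ℕ) (t : ℕ → ℝ), t 0 = 0 ∧ t m = 1 ∧
      ∀ i < m, t i < t (i + 1) ∧ ContDiffOn ℝ 1 γ (Set.Icc (t i) (t (i + 1)))

/-- The length `ℓ(γ) = ∫₀¹ r_P(γ(t)) ‖γ'(t)‖ dt`, with `r_P` the Euclidean distance to `P`.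
For a piecewise `C¹` path, `deriv γ t` is the velocity at all but finitely many `t ∈ [0, 1]`. -/
noncomputable def pathLength {d : ℕ} (P : Set (EuclideanSpace ℝ (Fin d)))
    (γ : ℝ → EuclideanSpace ℝ (Fin d)) : ℝ :=
  ∫ t in (0 : ℝ)..1, Metric.infDist (γ t) P * ‖deriv γ t‖

/-- The nearest-neighbor geodesic distance `d_N` with respect to `P`, on all of `ℝ^d`:
four times the infimum of the lengths of the piecewise `C¹` paths from `a` to `b`. -/
noncomputable def geodesicDist {d : ℕ} (P : Set (EuclideanSpace ℝ (Fin d)))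
    (a b : EuclideanSpace ℝ (Fin d)) : ℝ :=
  4 * sInf {l : ℝ | ∃ γ, IsPiecewiseC1Path a b γ ∧ l = pathLength P γ}

/-- The closed ball of `d_N` in `ℝ^d`. -/
def geodesicBall {d : ℕ} (P : Set (EuclideanSpace ℝ (Fin d)))
    (a : EuclideanSpace ℝ (Fin d)) (α : ℝ) : Set (EuclideanSpace ℝ (Fin d)) :=
  {x | geodesicDist P a x ≤ α}

/-- The intrinsic Čech complex of `(P, d_N)` at scale `α`: its simplices are the nonempty finite
subsets of `P` whose `d_N`-balls of radius `α` have a point of `ℝ^d` in common. -/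
def cechComplex {d : ℕ} (P : Set (EuclideanSpace ℝ (Fin d))) (α : ℝ) :
    PreAbstractSimplicialComplex (EuclideanSpace ℝ (Fin d)) where
  faces := {σ | σ.Nonempty ∧ (σ : Set (EuclideanSpace ℝ (Fin d))) ⊆ P ∧
    (⋂ x ∈ σ, geodesicBall P x α).Nonempty}
  isRelLowerSet_faces := by
    rintro σ ⟨h₁, h₂, z, hz⟩
    refine ⟨h₁, fun τ hτ hne => ⟨hne, fun x hx => h₂ (hτ hx), z, ?_⟩⟩
    simp only [Set.mem_iInter] at hz ⊢
    exact fun x hx => hz x (hτ hx)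

/-- The edges (simplices with two vertices) of the intrinsic Čech complex at scale `α`. -/
def cechEdges {d : ℕ} (P : Set (EuclideanSpace ℝ (Fin d))) (α : ℝ) :
    Set (Finset (EuclideanSpace ℝ (Fin d))) :=
  {σ | σ ∈ (cechComplex P α).faces ∧ σ.card = 2}

end NearestNeighbor

/-! ### A real random access machine

Memory consists of registers for natural numbers (counters and addresses), registers for real
numbers, and unbounded arrays of real numbers. Every elementary operation and every test takes one
step. Natural numbers can be added, subtracted (with truncation at `0`) and compared; real numbers
can be added, subtracted, multiplied and compared, all exactly; arrays are accessed through
addresses in natural number registers. There is no rounding, no root, no conversion between the two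
kinds of numbers, and programs contain only natural and rational constants. -/

namespace RealRAM

/-- A state of the memory: natural number registers, real registers, and arrays of reals
(`mem k c` is cell `c` of array `k`). -/
structure State where
  nat : ℕ → ℕ
  real : ℕ → ℝ
  mem : ℕ → ℕ → ℝ

/-- Programs. A program is a finite object, mentioning finitely many registers and arrays. -/
inductive Program where
  /-- natural register `x` := the constant `c` -/
  | natConst (x c : ℕ)
  /-- natural register `x` := `y + z` -/
  | natAdd (x y z : ℕ)
  /-- natural register `x` := `max (y - z) 0` -/
  | natSub (x y z : ℕ)
  /-- real register `x` := the constant `c` -/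
  | realConst (x : ℕ) (c : ℚ)
  /-- real register `x` := `y + z` -/
  | realAdd (x y z : ℕ)
  /-- real register `x` := `y - z` -/
  | realSub (x y z : ℕ)
  /-- real register `x` := `y * z` -/
  | realMul (x y z : ℕ)
  /-- real register `x` := the cell of array `k` whose address is in natural register `a` -/
  | load (x k a : ℕ)
  /-- the cell of array `k` whose address is in natural register `a` := real register `x` -/
  | store (k a x : ℕ)
  /-- first `p`, then `q` -/
  | seq (p q : Program)
  /-- if natural register `x` < natural register `y` then `p` else `q` -/
  | ifNat (x y : ℕ) (p q : Program)
  /-- if real register `x` < real register `y` then `p` else `q` -/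
  | ifReal (x y : ℕ) (p q : Program)
  /-- while natural register `x` < natural register `y` do `p` -/
  | whileNat (x y : ℕ) (p : Program)

/-- `Runs p s t s'`: the program `p`, started in state `s`, halts after exactly `t` steps in the
state `s'`. -/
inductive Runs : Program → State → ℕ → State → Prop where
  | natConst (s : State) (x c : ℕ) :
      Runs (.natConst x c) s 1 { s with nat := Function.update s.nat x c }
  | natAdd (s : State) (x y z : ℕ) :
      Runs (.natAdd x y z) s 1 { s with nat := Function.update s.nat x (s.nat y + s.nat z) }
  | natSub (s : State) (x y z : ℕ) :
      Runs (.natSub x y z) s 1 { s with nat := Function.update s.nat x (s.nat y - s.nat z) }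
  | realConst (s : State) (x : ℕ) (c : ℚ) :
      Runs (.realConst x c) s 1 { s with real := Function.update s.real x (c : ℝ) }
  | realAdd (s : State) (x y z : ℕ) :
      Runs (.realAdd x y z) s 1 { s with real := Function.update s.real x (s.real y + s.real z) }
  | realSub (s : State) (x y z : ℕ) :
      Runs (.realSub x y z) s 1 { s with real := Function.update s.real x (s.real y - s.real z) }
  | realMul (s : State) (x y z : ℕ) :
      Runs (.realMul x y z) s 1 { s with real := Function.update s.real x (s.real y * s.real z) }
  | load (s : State) (x k a : ℕ) :
      Runs (.load x k a) s 1 { s with real := Function.update s.real x (s.mem k (s.nat a)) }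
  | store (s : State) (k a x : ℕ) :
      Runs (.store k a x) s 1
        { s with mem := Function.update s.mem k
                          (Function.update (s.mem k) (s.nat a) (s.real x)) }
  | seq {p q : Program} {s s' s'' : State} {t t' : ℕ} :
      Runs p s t s' → Runs q s' t' s'' → Runs (.seq p q) s (t + t') s''
  | ifNat_true {x y : ℕ} {p q : Program} {s s' : State} {t : ℕ} :
      s.nat x < s.nat y → Runs p s t s' → Runs (.ifNat x y p q) s (t + 1) s'
  | ifNat_false {x y : ℕ} {p q : Program} {s s' : State} {t : ℕ} :
      ¬ s.nat x < s.nat y → Runs q s t s' → Runs (.ifNat x y p q) s (t + 1) s'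
  | ifReal_true {x y : ℕ} {p q : Program} {s s' : State} {t : ℕ} :
      s.real x < s.real y → Runs p s t s' → Runs (.ifReal x y p q) s (t + 1) s'
  | ifReal_false {x y : ℕ} {p q : Program} {s s' : State} {t : ℕ} :
      ¬ s.real x < s.real y → Runs q s t s' → Runs (.ifReal x y p q) s (t + 1) s'
  | whileNat_done {x y : ℕ} {p : Program} {s : State} :
      ¬ s.nat x < s.nat y → Runs (.whileNat x y p) s 1 s
  | whileNat_step {x y : ℕ} {p : Program} {s s' s'' : State} {t t' : ℕ} :
      s.nat x < s.nat y → Runs p s t s' → Runs (.whileNat x y p) s' t' s'' →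
        Runs (.whileNat x y p) s (t + t' + 1) s''

/-- The machine is deterministic: the number of steps and the final state are determined by the
program and the initial state. -/
theorem Runs.deterministic {p : Program} {s : State} {t₁ t₂ : ℕ} {s₁ s₂ : State}
    (h₁ : Runs p s t₁ s₁) (h₂ : Runs p s t₂ s₂) : t₁ = t₂ ∧ s₁ = s₂ := by
  induction h₁ generalizing t₂ s₂ with
  | seq _ _ ih ih' =>
    cases h₂ with
    | seq a b => obtain ⟨rfl, rfl⟩ := ih a; obtain ⟨rfl, rfl⟩ := ih' b; exact ⟨rfl, rfl⟩
  | ifNat_true h _ ih =>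
    cases h₂ with
    | ifNat_true _ a => obtain ⟨rfl, rfl⟩ := ih a; exact ⟨rfl, rfl⟩
    | ifNat_false h' _ => exact absurd h h'
  | ifNat_false h _ ih =>
    cases h₂ with
    | ifNat_true h' _ => exact absurd h' h
    | ifNat_false _ a => obtain ⟨rfl, rfl⟩ := ih a; exact ⟨rfl, rfl⟩
  | ifReal_true h _ ih =>
    cases h₂ with
    | ifReal_true _ a => obtain ⟨rfl, rfl⟩ := ih a; exact ⟨rfl, rfl⟩
    | ifReal_false h' _ => exact absurd h h'
  | ifReal_false h _ ih =>
    cases h₂ with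
    | ifReal_true h' _ => exact absurd h' h
    | ifReal_false _ a => obtain ⟨rfl, rfl⟩ := ih a; exact ⟨rfl, rfl⟩
  | whileNat_done h =>
    cases h₂ with
    | whileNat_done _ => exact ⟨rfl, rfl⟩
    | whileNat_step h' _ _ => exact absurd h' h
  | whileNat_step h _ _ ih ih' =>
    cases h₂ with
    | whileNat_done h' => exact absurd h h'
    | whileNat_step _ a b =>
      obtain ⟨rfl, rfl⟩ := ih a; obtain ⟨rfl, rfl⟩ := ih' b; exact ⟨rfl, rfl⟩
  | _ => cases h₂; exact ⟨rfl, rfl⟩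

/-- The initial state for `n` points in `ℝ^d`: natural registers `0` and `1` hold `n` and `d`,
cell `i * d + k` of array `0` holds coordinate `k` of point `i`, everything else is zero. -/
noncomputable def input {n d : ℕ} (p : Fin n → EuclideanSpace ℝ (Fin d)) : State where
  nat := fun x => if x = 0 then n else if x = 1 then d else 0
  real := fun _ => 0
  mem := fun k c =>
    if h : k = 0 ∧ c < n * d then
      p (finProdFinEquiv.symm ⟨c, h.2⟩).1 (finProdFinEquiv.symm ⟨c, h.2⟩).2
    else 0

/-- The `n × n` matrix written by a program into array `1`, row by row. -/
def output (s : State) (n : ℕ) (i j : Fin n) : ℝ :=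
  s.mem 1 (i * n + j)

end RealRAM

/-! Give each pair of points of `P` the weight `‖p - q‖ ^ 2` and let `δ` be the shortest-path
distance in this complete graph. The balls of radius `α` about `p i` and `p j` meet exactly when `δ
(p i) (p j) ≤ 2 * α`. Hence `β i j = δ (p i) (p j) / 2`, which Floyd-Warshall computes from half the
squared distances, needing neither division nor roots.

If `δ ≤ 2 * α`, the balls meet: on a segment of length `L` between points of `P`, `r_P` is at most
the distance to the nearer end, so the cost is at most `4 * 2 * ∫ r dr` over `[0, L / 2]`, which is
`L ^ 2`. A chain of such segments contains a point that splits the total cost in any prescribed way,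
in particular in half (`joinedWithin_dist_sq`, `JoinedWithin.trans`).

Conversely, `δ (p i) ·` is a potential on `P` that varies by at most `‖p - q‖ ^ 2`. By
`exists_quadratic_extension` it extends to a function `F` on the whole space that changes at `x` at
rate at most `4 * r_P x`, so along any path `F` changes by at most four times the length. Comparing
`F` at `p i`, `x` and `p j` bounds `δ (p i) (p j)` by the sum of the two geodesic distances to `x`
(`sub_le_geodesicDist_add_geodesicDist`). Neither minimizing paths nor Voronoi cells are needed. -/

namespace NearestNeighbor

open Filter Topology Set MeasureTheory

/-! ### Extending a potential from the finite set to the whole space -/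

section QuadraticExtension

variable {E : Type*} [NormedAddCommGroup E] [InnerProductSpace ℝ E]

/-- Up to the term in `t * (1 - t)`, the squared distance is affine along a segment. This makes the
concavity estimates below quantitative. -/
theorem norm_sub_add_smul_sq (z v p : E) (t : ℝ) :
    ‖z - (v + t • (p - v))‖ ^ 2 =
      (1 - t) * ‖z - v‖ ^ 2 + t * ‖z - p‖ ^ 2 - t * (1 - t) * ‖p - v‖ ^ 2 := by
  have h1 : z - (v + t • (p - v)) = (z - v) - t • (p - v) := by abel
  have h2 : z - p = (z - v) - (p - v) := by abel
  rw [h1, h2, norm_sub_sq_real (z - v), norm_sub_sq_real (z - v), inner_smul_right, norm_smul, mul_pow,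
    Real.norm_eq_abs, sq_abs]
  ring

/-- A function with `1`-Lipschitz growth in the squared distance on a finite set extends to a
function whose rate of change at `x` is at most four times the distance from `x` to the set. The
extension is a regularization by a double (inf and sup) convolution with quadratic kernels. -/
theorem exists_quadratic_extension [FiniteDimensional ℝ E] (P : Finset E) (hP : P.Nonempty)
    (D : E → ℝ) (hD : ∀ p ∈ P, ∀ q ∈ P, D p ≤ D q + ‖p - q‖ ^ 2) :
    ∃ F : E → ℝ, (∀ p ∈ P, F p = D p) ∧
      ∀ x y, ∀ p ∈ P, |F y - F x| ≤ 4 * ‖x - p‖ * ‖y - x‖ + 6 * ‖y - x‖ ^ 2 := by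
  set φ : E → ℝ := fun w => P.inf' hP fun q => D q + ‖q - w‖ ^ 2 with hφ
  have φle : ∀ w, ∀ q ∈ P, φ w ≤ D q + ‖q - w‖ ^ 2 := fun w q hq =>
    Finset.inf'_le (fun q => D q + ‖q - w‖ ^ 2) hq
  have leφ : ∀ w c, (∀ q ∈ P, c ≤ D q + ‖q - w‖ ^ 2) → c ≤ φ w := fun w c h =>
    Finset.le_inf' hP _ h
  have φP : ∀ p ∈ P, φ p = D p := fun p hp => by
    refine le_antisymm (by simpa using φle p p hp) (leφ _ _ fun q hq => ?_)
    rw [norm_sub_rev]; exact hD p hp q hq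
  have φcont : Continuous φ := by
    refine Continuous.finset_inf'_apply hP fun q _ => ?_
    fun_prop
  have hmax : ∀ x, ∃ v, ∀ w, φ w - 2 * ‖x - w‖ ^ 2 ≤ φ v - 2 * ‖x - v‖ ^ 2 := by
    intro x
    obtain ⟨p, hp⟩ := hP
    -- The kernel `2 * ‖x - w‖ ^ 2` outgrows `φ`, which is at most one parabola of coefficient `1`,
    -- so the supremum is attained.
    refine Continuous.exists_forall_ge (f := fun w => φ w - 2 * ‖x - w‖ ^ 2) (by fun_prop) ?_
    refine tendsto_atBot_mono (f := fun w => (D p + 3 * ‖p - x‖ ^ 2 + 1 / 2) - dist x w) ?_ ?_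
    · intro w
      have h1 := φle w p hp
      have h2 : ‖p - w‖ ≤ ‖p - x‖ + ‖x - w‖ := norm_sub_le_norm_sub_add_norm_sub p x w
      have h3 : ‖p - w‖ ^ 2 ≤ (‖p - x‖ + ‖x - w‖) ^ 2 := by gcongr
      rw [dist_eq_norm]
      nlinarith [sq_nonneg (2 * ‖p - x‖ - ‖x - w‖), sq_nonneg (‖x - w‖ - 1)]
    · have := tendsto_dist_left_cocompact_atTop x
      exact tendsto_atBot_add_const_left _ _ (tendsto_neg_atTop_atBot.comp this)
  choose v hv using hmax
  have vle : ∀ x, ∀ p ∈ P, ‖x - v x‖ ≤ ‖x - p‖ := by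
    intro x p hp
    -- Each parabola `D q + ‖q - w‖ ^ 2` satisfies this with equality, and the minimum inherits the
    -- inequality.
    have concave : ∀ t : ℝ, 0 ≤ t → t ≤ 1 →
        (1 - t) * φ (v x) + t * φ p - t * (1 - t) * ‖p - v x‖ ^ 2
          ≤ φ (v x + t • (p - v x)) := by
      intro t h0 h1
      refine leφ _ _ fun q hq => ?_
      rw [norm_sub_add_smul_sq]
      have ha := mul_le_mul_of_nonneg_left (φle (v x) q hq) (sub_nonneg.2 h1)
      have hb := mul_le_mul_of_nonneg_left (φle p q hq) h0
      nlinarith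
    -- Subtracting the kernel of coefficient `2` leaves strong concavity, so the value falls from
    -- its maximum at `v x` by at least `‖p - v x‖ ^ 2`; this is the limit `t → 0` of the comparison
    -- along the segment to `p`.
    have growth : φ p - 2 * ‖x - p‖ ^ 2 + ‖p - v x‖ ^ 2 ≤ φ (v x) - 2 * ‖x - v x‖ ^ 2 := by
      have key : ∀ t : ℝ, 0 < t → t < 1 →
          φ p - 2 * ‖x - p‖ ^ 2 + (1 - t) * ‖p - v x‖ ^ 2 ≤ φ (v x) - 2 * ‖x - v x‖ ^ 2 := by
        intro t h0 h1
        have ha := concave t h0.le h1.le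
        have hb := hv x (v x + t • (p - v x))
        rw [norm_sub_add_smul_sq] at hb
        refine le_of_mul_le_mul_left ?_ h0
        nlinarith
      have lim : Tendsto (fun t : ℝ => φ p - 2 * ‖x - p‖ ^ 2 + (1 - t) * ‖p - v x‖ ^ 2)
          (𝓝[>] 0) (𝓝 (φ p - 2 * ‖x - p‖ ^ 2 + (1 - 0) * ‖p - v x‖ ^ 2)) :=
        (Continuous.tendsto (by fun_prop) 0).mono_left nhdsWithin_le_nhds
      rw [sub_zero, one_mul] at lim
      refine le_of_tendsto lim ?_
      filter_upwards [Ioo_mem_nhdsGT (zero_lt_one (α := ℝ))] with t ht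
      exact key t ht.1 ht.2
    -- The term `‖p - v x‖ ^ 2` cancels between this bound and `growth`, leaving `‖x - v x‖ ^ 2 ≤ ‖x
    -- - p‖ ^ 2`.
    have h := φle (v x) p hp
    rw [φP p hp] at growth
    exact le_of_sq_le_sq (by nlinarith) (norm_nonneg _)
  have onesided : ∀ x y, ∀ p ∈ P, (φ (v x) - 2 * ‖x - v x‖ ^ 2) - (φ (v y) - 2 * ‖y - v y‖ ^ 2)
      ≤ 4 * ‖x - p‖ * ‖y - x‖ + 2 * ‖y - x‖ ^ 2 := by
    intro x y p hp
    -- `v x` competes in the supremum at `y`; expanding the kernel gives the factor `4 = 2 * 2`.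
    have h1 := hv y (v x)
    have h2 : ‖y - v x‖ ≤ ‖y - x‖ + ‖x - v x‖ := norm_sub_le_norm_sub_add_norm_sub y x (v x)
    have h3 : ‖y - v x‖ ^ 2 ≤ (‖y - x‖ + ‖x - v x‖) ^ 2 := by gcongr
    have h4 := mul_le_mul_of_nonneg_right (vle x p hp) (norm_nonneg (y - x))
    nlinarith
  refine ⟨fun x => φ (v x) - 2 * ‖x - v x‖ ^ 2, fun p hp => ?_, fun x y p hp => ?_⟩
  · have h := vle p p hp
    rw [sub_self, norm_zero, norm_le_zero_iff, sub_eq_zero] at h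
    simp [← h, φP p hp]
  · rw [abs_le]
    have h1 := onesided x y p hp
    have h2 := onesided y x p hp
    rw [norm_sub_rev x y] at h2
    -- Replacing `‖y - p‖` by `‖x - p‖` in the reversed estimate raises the quadratic coefficient
    -- from `2` to `6`.
    have h3 : ‖y - p‖ ≤ ‖y - x‖ + ‖x - p‖ := norm_sub_le_norm_sub_add_norm_sub y x p
    have h4 := mul_le_mul_of_nonneg_right h3 (norm_nonneg (y - x))
    constructor <;> nlinarith [sq_nonneg ‖y - x‖]

end QuadraticExtension

/-! ### Lower bounds for the geodesic distance by potentials -/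

variable {d : ℕ}

/-- At the two ends of a piece `deriv γ` may have nothing to do with the piece. The one-sided
derivative gives a continuous integrand, equal to the original one off these two points and extended
to all of `ℝ` so that the fundamental theorem of calculus applies everywhere. -/
theorem intervalIntegrable_pathLength {u v : ℝ} (huv : u < v) (P : Set (EuclideanSpace ℝ (Fin d)))
    {γ : ℝ → EuclideanSpace ℝ (Fin d)} (hγ : ContDiffOn ℝ 1 γ (Icc u v)) :
    ∃ g : ℝ → ℝ, Continuous g ∧
      (∀ t ∈ Icc u v, g t = Metric.infDist (γ t) P * ‖derivWithin γ (Icc u v) t‖) ∧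
      (∀ a b, Icc a b ⊆ Icc u v → a ≤ b →
        IntervalIntegrable (fun t => Metric.infDist (γ t) P * ‖deriv γ t‖) volume a b ∧
        ∫ t in a..b, Metric.infDist (γ t) P * ‖deriv γ t‖ = ∫ t in a..b, g t) := by
  have hc : ContinuousOn (fun t => Metric.infDist (γ t) P * ‖derivWithin γ (Icc u v) t‖)
      (Icc u v) :=
    ((Metric.continuous_infDist_pt P).comp_continuousOn hγ.continuousOn).mul
      (hγ.continuousOn_derivWithin (uniqueDiffOn_Icc huv) le_rfl).norm
  set g := IccExtend huv.le ((Icc u v).domRestrict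
    (fun t => Metric.infDist (γ t) P * ‖derivWithin γ (Icc u v) t‖)) with hg
  have gcont : Continuous g := (continuousOn_iff_continuous_domRestrict.1 hc).Icc_extend'
  have geq : ∀ t ∈ Icc u v, g t = Metric.infDist (γ t) P * ‖derivWithin γ (Icc u v) t‖ :=
    fun t ht => by rw [hg, IccExtend_of_mem _ _ ht]; rfl
  refine ⟨g, gcont, geq, fun a b hab hle => ?_⟩
  have hae : ∀ᵐ t ∂volume, t ∈ uIoc a b → g t = Metric.infDist (γ t) P * ‖deriv γ t‖ := by
    have h0 : ∀ᵐ t : ℝ ∂volume, t ≠ u ∧ t ≠ v := by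
      have h1 : ∀ c : ℝ, ∀ᵐ t : ℝ ∂volume, t ≠ c := fun c => by
        simp [ae_iff]
      filter_upwards [h1 u, h1 v] with t h2 h3 using ⟨h2, h3⟩
    filter_upwards [h0] with t ht htab
    rw [uIoc_of_le hle] at htab
    have htm := hab (Ioc_subset_Icc_self htab)
    rw [geq t htm, derivWithin_of_mem_nhds
      (Icc_mem_nhds (lt_of_le_of_ne htm.1 ht.1.symm) (lt_of_le_of_ne htm.2 ht.2))]
  refine ⟨?_, (intervalIntegral.integral_congr_ae hae).symm⟩
  refine (gcont.intervalIntegrable a b).congr_ae ?_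
  rw [Filter.EventuallyEq, ae_restrict_iff' measurableSet_uIoc]
  exact hae

/-- A function whose rate of change at `x` is at most `4 r_P(x)` grows along a `C¹` arc by at most
four times the length of the arc. -/
theorem sub_le_integral_of_contDiffOn {u v : ℝ} (huv : u < v)
    {P : Set (EuclideanSpace ℝ (Fin d))}
    {F : EuclideanSpace ℝ (Fin d) → ℝ}
    (hF : ∀ x y, |F y - F x| ≤ 4 * Metric.infDist x P * ‖y - x‖ + 6 * ‖y - x‖ ^ 2)
    {γ : ℝ → EuclideanSpace ℝ (Fin d)} (hγ : ContDiffOn ℝ 1 γ (Icc u v)) :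
    F (γ v) - F (γ u) ≤ 4 * ∫ t in u..v, Metric.infDist (γ t) P * ‖deriv γ t‖ := by
  obtain ⟨g, gcont, geq, gint⟩ := intervalIntegrable_pathLength huv P hγ
  rw [(gint u v subset_rfl huv.le).2]
  have Fcont : Continuous F := by
    rw [continuous_iff_continuousAt]
    intro x
    rw [ContinuousAt, tendsto_iff_dist_tendsto_zero]
    refine squeeze_zero (fun _ => dist_nonneg) (fun y => hF x y) ?_
    have : Continuous fun y => 4 * Metric.infDist x P * ‖y - x‖ + 6 * ‖y - x‖ ^ 2 := by fun_prop
    simpa using this.tendsto x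
  have hB : ∀ t, HasDerivAt (fun t => F (γ u) + 4 * ∫ s in u..t, g s) (4 * g t) t := fun t =>
    ((intervalIntegral.integral_hasDerivAt_right (gcont.intervalIntegrable _ _)
      (gcont.stronglyMeasurableAtFilter _ _) gcont.continuousAt).const_mul 4).const_add _
  -- `F ∘ γ` is not known to be differentiable; a bound on its right slopes suffices.
  have main := image_le_of_liminf_slope_right_le_deriv_boundary (f := fun t => F (γ t))
    (a := u) (b := v) (B := fun t => F (γ u) + 4 * ∫ s in u..t, g s) (B' := fun t => 4 * g t)
    (Fcont.comp_continuousOn hγ.continuousOn) (by simp)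
    (fun t _ => (hB t).continuousAt.continuousWithinAt)
    (fun t _ => (hB t).hasDerivWithinAt) ?_ (right_mem_Icc.2 huv.le)
  · linarith
  intro t ht r hr
  refine Eventually.frequently ?_
  have htm : t ∈ Icc u v := Ico_subset_Icc_self ht
  have hd : HasDerivWithinAt γ (derivWithin γ (Icc u v) t) (Ioi t) t :=
    ((hγ.differentiableOn one_ne_zero t htm).hasDerivWithinAt).mono_of_mem_nhdsWithin
      (mem_of_superset (Ioo_mem_nhdsGT ht.2)
        fun z hz => ⟨ht.1.trans hz.1.le, hz.2.le⟩)
  have hs := (hasDerivWithinAt_iff_tendsto_slope' (by simp)).1 hd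
  have hcz : Tendsto (fun z => ‖γ z - γ t‖) (𝓝[>] t) (𝓝 0) := by
    have h1 : Tendsto (fun z => γ z - γ t) (𝓝[>] t) (𝓝 (γ t - γ t)) :=
      hd.continuousWithinAt.tendsto.sub_const _
    simpa using h1.norm
  -- Divided by `z - t`, the quadratic error is a vanishing increment times a bounded slope, so it
  -- disappears in the limit.
  have lim : Tendsto (fun z => 4 * Metric.infDist (γ t) P * ‖slope γ t z‖
      + 6 * (‖γ z - γ t‖ * ‖slope γ t z‖)) (𝓝[>] t)
      (𝓝 (4 * Metric.infDist (γ t) P * ‖derivWithin γ (Icc u v) t‖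
        + 6 * (0 * ‖derivWithin γ (Icc u v) t‖))) :=
    (hs.norm.const_mul _).add ((hcz.mul hs.norm).const_mul _)
  have hlt : 4 * Metric.infDist (γ t) P * ‖derivWithin γ (Icc u v) t‖
        + 6 * (0 * ‖derivWithin γ (Icc u v) t‖) < r := by
    rw [geq t htm] at hr; linarith
  filter_upwards [lim.eventually_lt_const hlt, self_mem_nhdsWithin] with z hz htz
  refine lt_of_le_of_lt ?_ hz
  have hpos : 0 < z - t := sub_pos.2 htz
  have h1 := (le_abs_self _).trans (hF (γ t) (γ z))
  have h2 : ‖slope γ t z‖ = ‖γ z - γ t‖ / (z - t) := by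
    rw [slope_def_module, norm_smul, norm_inv, Real.norm_eq_abs, abs_of_pos hpos]
    field_simp
  rw [slope_def_field, h2, div_le_iff₀ hpos]
  refine h1.trans (le_of_eq ?_)
  field_simp

theorem IsPiecewiseC1Path.sub_le_pathLength {a b : EuclideanSpace ℝ (Fin d)}
    {P : Set (EuclideanSpace ℝ (Fin d))} {F : EuclideanSpace ℝ (Fin d) → ℝ}
    (hF : ∀ x y, |F y - F x| ≤ 4 * Metric.infDist x P * ‖y - x‖ + 6 * ‖y - x‖ ^ 2)
    {γ : ℝ → EuclideanSpace ℝ (Fin d)} (hγ : IsPiecewiseC1Path a b γ) :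
    F b - F a ≤ 4 * pathLength P γ := by
  obtain ⟨rfl, rfl, -, m, t, h0, h1, ht⟩ := hγ
  have hsum := intervalIntegral.sum_integral_adjacent_intervals (a := t) (n := m)
    (f := fun t => Metric.infDist (γ t) P * ‖deriv γ t‖) (μ := volume) fun k hk => by
      obtain ⟨g, -, -, hg⟩ := intervalIntegrable_pathLength (ht k hk).1 P (ht k hk).2
      exact (hg _ _ subset_rfl (ht k hk).1.le).1
  rw [h0, h1] at hsum
  have htel := Finset.sum_range_sub (fun i => F (γ (t i))) m
  simp only [h0, h1] at htel
  rw [pathLength, ← hsum, ← htel, Finset.mul_sum]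
  exact Finset.sum_le_sum fun k hk =>
    sub_le_integral_of_contDiffOn (ht k (Finset.mem_range.1 hk)).1 hF
      (ht k (Finset.mem_range.1 hk)).2

theorem isPiecewiseC1Path_segment (a b : EuclideanSpace ℝ (Fin d)) :
    IsPiecewiseC1Path a b fun t => a + t • (b - a) := by
  refine ⟨by simp, by simp, by fun_prop, 1, fun i => i, by simp, by simp, fun i hi => ⟨by simp, ?_⟩⟩
  exact ContDiff.contDiffOn (by fun_prop)

theorem sub_le_geodesicDist {P : Set (EuclideanSpace ℝ (Fin d))}
    {F : EuclideanSpace ℝ (Fin d) → ℝ}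
    (hF : ∀ x y, |F y - F x| ≤ 4 * Metric.infDist x P * ‖y - x‖ + 6 * ‖y - x‖ ^ 2)
    (a b : EuclideanSpace ℝ (Fin d)) : F b - F a ≤ geodesicDist P a b := by
  have : (F b - F a) / 4 ≤ sInf {l : ℝ | ∃ γ, IsPiecewiseC1Path a b γ ∧ l = pathLength P γ} := by
    refine le_csInf ⟨_, _, isPiecewiseC1Path_segment a b, rfl⟩ ?_
    rintro _ ⟨γ, hγ, rfl⟩
    linarith [hγ.sub_le_pathLength hF]
  rw [geodesicDist]
  linarith

/-- A function on `P` that grows at most like the squared distance is a lower bound for the sum of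
the geodesic distances from two points of `P` to any point. -/
theorem sub_le_geodesicDist_add_geodesicDist {P : Set (EuclideanSpace ℝ (Fin d))}
    (hfin : P.Finite) {D : EuclideanSpace ℝ (Fin d) → ℝ}
    (hD : ∀ p ∈ P, ∀ q ∈ P, D p ≤ D q + ‖p - q‖ ^ 2) {p q : EuclideanSpace ℝ (Fin d)}
    (hp : p ∈ P) (hq : q ∈ P) (x : EuclideanSpace ℝ (Fin d)) :
    D q - D p ≤ geodesicDist P p x + geodesicDist P q x := by
  obtain ⟨F, hFD, hF⟩ := exists_quadratic_extension hfin.toFinset ⟨p, by simpa using hp⟩ D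
    (by simpa using hD)
  have hF' : ∀ x y, |F y - F x| ≤ 4 * Metric.infDist x P * ‖y - x‖ + 6 * ‖y - x‖ ^ 2 := by
    intro x y
    obtain ⟨z, hz, hxz⟩ := hfin.isCompact.exists_infDist_eq_dist ⟨p, hp⟩ x
    rw [hxz, dist_eq_norm]
    exact hF x y z (by simpa using hz)
  have h1 := sub_le_geodesicDist hF' p x
  -- The growth bound is symmetric in sign; using `-F` bounds `F q - F x` with the path still
  -- starting at `q`.
  have h2 := sub_le_geodesicDist (F := fun x => -F x)
    (fun x y => by rw [← neg_sub_neg, abs_sub_comm]; simpa [abs_sub_comm] using hF' x y) q x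
  rw [hFD p (by simpa using hp)] at h1
  rw [hFD q (by simpa using hq)] at h2
  linarith

/-! ### Upper bounds for the geodesic distance by explicit paths -/

theorem pathLength_nonneg (P : Set (EuclideanSpace ℝ (Fin d)))
    (γ : ℝ → EuclideanSpace ℝ (Fin d)) : 0 ≤ pathLength P γ :=
  intervalIntegral.integral_nonneg zero_le_one fun _ _ =>
    mul_nonneg Metric.infDist_nonneg (norm_nonneg _)

theorem bddBelow_pathLength (P : Set (EuclideanSpace ℝ (Fin d)))
    (a b : EuclideanSpace ℝ (Fin d)) :
    BddBelow {l : ℝ | ∃ γ, IsPiecewiseC1Path a b γ ∧ l = pathLength P γ} := by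
  refine ⟨0, ?_⟩
  rintro _ ⟨γ, -, rfl⟩
  exact pathLength_nonneg P γ

theorem IsPiecewiseC1Path.geodesicDist_le {P : Set (EuclideanSpace ℝ (Fin d))}
    {a b : EuclideanSpace ℝ (Fin d)} {γ : ℝ → EuclideanSpace ℝ (Fin d)}
    (hγ : IsPiecewiseC1Path a b γ) : geodesicDist P a b ≤ 4 * pathLength P γ := by
  have := csInf_le (bddBelow_pathLength P a b) ⟨γ, hγ, rfl⟩
  rw [geodesicDist]
  linarith

theorem IsPiecewiseC1Path.intervalIntegrable {a b : EuclideanSpace ℝ (Fin d)}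
    {γ : ℝ → EuclideanSpace ℝ (Fin d)} (hγ : IsPiecewiseC1Path a b γ)
    (P : Set (EuclideanSpace ℝ (Fin d))) :
    IntervalIntegrable (fun t => Metric.infDist (γ t) P * ‖deriv γ t‖) volume 0 1 := by
  obtain ⟨-, -, -, m, t, h0, h1, ht⟩ := hγ
  rw [← h0, ← h1]
  refine IntervalIntegrable.trans_iterate fun k hk => ?_
  obtain ⟨g, -, -, hg⟩ := intervalIntegrable_pathLength (ht k hk).1 P (ht k hk).2
  exact (hg _ _ subset_rfl (ht k hk).1.le).1

theorem le_of_partition {t : ℕ → ℝ} {m : ℕ} (ht : ∀ i < m, t i < t (i + 1)) {i j : ℕ}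
    (hij : i ≤ j) (hj : j ≤ m) : t i ≤ t j := by
  induction j, hij using Nat.le_induction with
  | base => exact le_rfl
  | succ j _ ih => exact (ih (by omega)).trans (ht j (by omega)).le

theorem IsPiecewiseC1Path.exists_trans {a b c : EuclideanSpace ℝ (Fin d)}
    {γ₁ γ₂ : ℝ → EuclideanSpace ℝ (Fin d)} (h₁ : IsPiecewiseC1Path a b γ₁)
    (h₂ : IsPiecewiseC1Path b c γ₂) (P : Set (EuclideanSpace ℝ (Fin d))) :
    ∃ γ, IsPiecewiseC1Path a c γ ∧ pathLength P γ = pathLength P γ₁ + pathLength P γ₂ := by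
  set γ : ℝ → EuclideanSpace ℝ (Fin d) :=
    fun t => if t ≤ 1 / 2 then γ₁ (2 * t) else γ₂ (2 * t - 1)
  have hl : ∀ t ≤ 1 / 2, γ t = γ₁ (2 * t) := fun t ht => if_pos ht
  have hr : ∀ t, 1 / 2 ≤ t → γ t = γ₂ (2 * t - 1) := fun t ht => by
    rcases ht.eq_or_lt with rfl | ht
    · rw [hl _ le_rfl]; norm_num [h₁.2.1, h₂.1]
    · exact if_neg (not_le.2 ht)
  have hγ : IsPiecewiseC1Path a c γ := by
    obtain ⟨e1, f1, c1, m₁, t₁, a1, b1, ht₁⟩ := h₁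
    obtain ⟨e2, f2, c2, m₂, t₂, a2, b2, ht₂⟩ := h₂
    refine ⟨by rw [hl _ (by norm_num)]; simpa using e1,
      by rw [hr _ (by norm_num)]; norm_num [f2], ?_,
      m₁ + m₂, fun i => if i ≤ m₁ then t₁ i / 2 else (1 + t₂ (i - m₁)) / 2, by simp [a1], ?_, ?_⟩
    · have hu : Icc (0 : ℝ) 1 = Icc 0 (1 / 2) ∪ Icc (1 / 2) 1 :=
        (Icc_union_Icc_eq_Icc (by norm_num) (by norm_num)).symm
      rw [hu]
      refine ContinuousOn.union_of_isClosed ?_ ?_ isClosed_Icc isClosed_Icc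
      · refine ContinuousOn.congr (c1.comp (f := fun t => 2 * t) (by fun_prop) ?_)
          fun t ht => hl t ht.2
        intro t ht; constructor <;> linarith [ht.1, ht.2]
      · refine ContinuousOn.congr (c2.comp (f := fun t => 2 * t - 1) (by fun_prop) ?_)
          fun t ht => hr t ht.1
        intro t ht; constructor <;> linarith [ht.1, ht.2]
    · rcases Nat.eq_zero_or_pos m₂ with rfl | hm
      · linarith
      · simp only [if_neg (show ¬ m₁ + m₂ ≤ m₁ by omega), Nat.add_sub_cancel_left, b2]
        norm_num
    · intro i hi
      by_cases h : i < m₁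
      · have hle := le_of_partition (fun i hi => (ht₁ i hi).1) (show i + 1 ≤ m₁ by omega) le_rfl
        simp only [if_pos h.le, if_pos (show i + 1 ≤ m₁ by omega)]
        refine ⟨by linarith [(ht₁ i h).1], ?_⟩
        refine ContDiffOn.congr ((ht₁ i h).2.comp (f := fun t => 2 * t)
          (by fun_prop) ?_) fun t ht => hl t ?_
        · intro t ht; constructor <;> linarith [ht.1, ht.2]
        · linarith [ht.2]
      · obtain ⟨k, rfl⟩ := Nat.exists_eq_add_of_le (not_lt.1 h)
        have hk : k < m₂ := by omega
        have hle := le_of_partition (fun i hi => (ht₂ i hi).1) (Nat.zero_le k) hk.le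
        have e1 : (if m₁ + k ≤ m₁ then t₁ (m₁ + k) / 2 else (1 + t₂ (m₁ + k - m₁)) / 2)
            = (1 + t₂ k) / 2 := by
          rcases Nat.eq_zero_or_pos k with rfl | hk0
          · simp [b1, a2]
          · rw [if_neg (by omega), Nat.add_sub_cancel_left]
        have e2 : (if m₁ + k + 1 ≤ m₁ then t₁ (m₁ + k + 1) / 2
            else (1 + t₂ (m₁ + k + 1 - m₁)) / 2) = (1 + t₂ (k + 1)) / 2 := by
          rw [if_neg (by omega), show m₁ + k + 1 - m₁ = k + 1 by omega]
        simp only [e1, e2]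
        refine ⟨by linarith [(ht₂ k hk).1], ?_⟩
        refine ContDiffOn.congr ((ht₂ k hk).2.comp (f := fun t => 2 * t - 1)
          (by fun_prop) ?_) fun t ht => hr t ?_
        · intro t ht; constructor <;> linarith [ht.1, ht.2]
        · linarith [ht.1]
  refine ⟨γ, hγ, ?_⟩
  have hint := hγ.intervalIntegrable P
  have hne : ∀ᵐ t : ℝ ∂volume, t ≠ 1 / 2 := by simp [ae_iff]
  have i1 : ∫ t in (0 : ℝ)..(1 / 2), Metric.infDist (γ t) P * ‖deriv γ t‖ = pathLength P γ₁ := by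
    have : ∫ t in (0 : ℝ)..(1 / 2), Metric.infDist (γ t) P * ‖deriv γ t‖ =
        ∫ t in (0 : ℝ)..(1 / 2), 2 * (Metric.infDist (γ₁ (2 * t)) P * ‖deriv γ₁ (2 * t)‖) := by
      refine intervalIntegral.integral_congr_ae ?_
      filter_upwards [hne] with t ht hm
      rw [uIoc_of_le (by norm_num)] at hm
      have hlt : t < 1 / 2 := lt_of_le_of_ne hm.2 ht
      have hev : γ =ᶠ[𝓝 t] fun t => γ₁ (2 * t) := by
        filter_upwards [Iio_mem_nhds hlt] with s hs using hl s hs.le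
      rw [hev.deriv_eq, hl t hm.2, deriv_comp_mul_left, norm_smul]
      norm_num
      ring
    rw [this, intervalIntegral.integral_const_mul,
      intervalIntegral.integral_comp_mul_left
        (fun t => Metric.infDist (γ₁ t) P * ‖deriv γ₁ t‖) two_ne_zero]
    norm_num [pathLength]
    ring
  have i2 : ∫ t in (1 / 2 : ℝ)..1, Metric.infDist (γ t) P * ‖deriv γ t‖ = pathLength P γ₂ := by
    have : ∫ t in (1 / 2 : ℝ)..1, Metric.infDist (γ t) P * ‖deriv γ t‖ =
        ∫ t in (1 / 2 : ℝ)..1,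
          2 * (Metric.infDist (γ₂ (2 * t - 1)) P * ‖deriv γ₂ (2 * t - 1)‖) := by
      refine intervalIntegral.integral_congr_ae ?_
      filter_upwards [hne] with t ht hm
      rw [uIoc_of_le (by norm_num)] at hm
      have hev : γ =ᶠ[𝓝 t] fun t => γ₂ (2 * t - 1) := by
        filter_upwards [Ioi_mem_nhds hm.1] with s hs using hr s (le_of_lt hs)
      rw [hev.deriv_eq, hr t hm.1.le, deriv_comp_mul_left (2 : ℝ) (fun y => γ₂ (y - 1)),
        deriv_comp_sub_const, norm_smul]
      norm_num
      ring
    rw [this, intervalIntegral.integral_const_mul,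
      intervalIntegral.integral_comp_mul_sub
        (fun t => Metric.infDist (γ₂ t) P * ‖deriv γ₂ t‖) two_ne_zero]
    norm_num [pathLength]
    ring
  rw [← i1, ← i2, pathLength]
  refine (intervalIntegral.integral_add_adjacent_intervals (hint.mono_set ?_)
    (hint.mono_set ?_)).symm <;>
  · rw [uIcc_of_le (by norm_num), uIcc_of_le (by norm_num)]
    exact Icc_subset_Icc (by norm_num) (by norm_num)

theorem geodesicDist_triangle (P : Set (EuclideanSpace ℝ (Fin d)))
    (a b c : EuclideanSpace ℝ (Fin d)) :
    geodesicDist P a c ≤ geodesicDist P a b + geodesicDist P b c := by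
  have hne : ∀ a b : EuclideanSpace ℝ (Fin d),
      {l : ℝ | ∃ γ, IsPiecewiseC1Path a b γ ∧ l = pathLength P γ}.Nonempty :=
    fun a b => ⟨_, _, isPiecewiseC1Path_segment a b, rfl⟩
  refine le_of_forall_pos_le_add fun ε hε => ?_
  obtain ⟨_, ⟨γ₁, h₁, rfl⟩, l₁⟩ := exists_lt_of_csInf_lt (hne a b)
    (lt_add_of_pos_right _ (show 0 < ε / 8 by positivity))
  obtain ⟨_, ⟨γ₂, h₂, rfl⟩, l₂⟩ := exists_lt_of_csInf_lt (hne b c)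
    (lt_add_of_pos_right _ (show 0 < ε / 8 by positivity))
  obtain ⟨γ, h, hl⟩ := h₁.exists_trans h₂ P
  have := h.geodesicDist_le (P := P)
  simp only [geodesicDist] at *
  linarith

/-- Moving along a ray that starts at a point of `P`. -/
theorem geodesicDist_ray_le {P : Set (EuclideanSpace ℝ (Fin d))}
    {p : EuclideanSpace ℝ (Fin d)} (hp : p ∈ P) (h : EuclideanSpace ℝ (Fin d)) {a b : ℝ}
    (ha : 0 ≤ a) (hb : 0 ≤ b) :
    geodesicDist P (p + a • h) (p + b • h) ≤ 2 * |b ^ 2 - a ^ 2| * ‖h‖ ^ 2 := by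
  have hγ := isPiecewiseC1Path_segment (p + a • h) (p + b • h)
  refine hγ.geodesicDist_le.trans ?_
  have hd : ∀ t, deriv (fun t : ℝ => p + a • h + t • (p + b • h - (p + a • h))) t
      = (b - a) • h := by
    intro t
    have := ((hasDerivAt_id t).smul_const (p + b • h - (p + a • h))).const_add (p + a • h)
    rw [sub_smul]
    simpa using this.deriv
  -- On the ray, `r_P` is bounded by the distance to `p` alone, which is linear in the parameter;
  -- its integral produces the difference of squares.
  have hle : pathLength P (fun t : ℝ => p + a • h + t • (p + b • h - (p + a • h))) ≤
      ∫ t in (0 : ℝ)..1, (a + t * (b - a)) * (|b - a| * ‖h‖ ^ 2) := by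
    refine intervalIntegral.integral_mono_on zero_le_one (hγ.intervalIntegrable P)
      (Continuous.intervalIntegrable (by fun_prop) _ _) fun t ht => ?_
    rw [hd, norm_smul, Real.norm_eq_abs]
    have hpos : 0 ≤ a + t * (b - a) := by nlinarith [ht.1, ht.2]
    have h1 : Metric.infDist (p + a • h + t • (p + b • h - (p + a • h))) P
        ≤ (a + t * (b - a)) * ‖h‖ := by
      refine (Metric.infDist_le_dist_of_mem hp).trans (le_of_eq ?_)
      rw [dist_eq_norm, show p + a • h + t • (p + b • h - (p + a • h)) - p
        = (a + t * (b - a)) • h by module, norm_smul, Real.norm_eq_abs, abs_of_nonneg hpos]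
    calc _ ≤ (a + t * (b - a)) * ‖h‖ * (|b - a| * ‖h‖) := by gcongr
      _ = _ := by ring
  have hval : ∫ t in (0 : ℝ)..1, (a + t * (b - a)) * (|b - a| * ‖h‖ ^ 2)
      = (a + b) / 2 * (|b - a| * ‖h‖ ^ 2) := by
    rw [intervalIntegral.integral_mul_const, intervalIntegral.integral_add (by simp)
      (Continuous.intervalIntegrable (by fun_prop) _ _), intervalIntegral.integral_mul_const]
    simp
    left; ring
  have habs : |b ^ 2 - a ^ 2| = (a + b) * |b - a| := by
    rw [show b ^ 2 - a ^ 2 = (a + b) * (b - a) by ring, abs_mul, abs_of_nonneg (by positivity)]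
  rw [habs]
  rw [hval] at hle
  nlinarith

/-- `a` and `b` are joined by a chain of points whose geodesic distances from `a` and `b` add up
to at most `c`. -/
def JoinedWithin (P : Set (EuclideanSpace ℝ (Fin d))) (a b : EuclideanSpace ℝ (Fin d))
    (c : ℝ) : Prop :=
  geodesicDist P a b ≤ c ∧ geodesicDist P b a ≤ c ∧
    ∀ s, 0 ≤ s → s ≤ c → ∃ x, geodesicDist P a x ≤ s ∧ geodesicDist P b x ≤ c - s

/-- The splitting point for `s` lies on the first or the second chain according to whether `s ≤ c`.
Distance bounds in both directions are carried along, which takes the place of symmetry of the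
geodesic distance. -/
theorem JoinedWithin.trans {P : Set (EuclideanSpace ℝ (Fin d))}
    {a b e : EuclideanSpace ℝ (Fin d)} {c c' : ℝ} (h : JoinedWithin P a b c)
    (h' : JoinedWithin P b e c') : JoinedWithin P a e (c + c') := by
  refine ⟨?_, ?_, fun s hs hsc => ?_⟩
  · linarith [geodesicDist_triangle P a b e, h.1, h'.1]
  · linarith [geodesicDist_triangle P e b a, h.2.1, h'.2.1]
  · rcases le_total s c with hle | hle
    · obtain ⟨x, h1, h2⟩ := h.2.2 s hs hle
      exact ⟨x, h1, by linarith [geodesicDist_triangle P e b x, h'.2.1]⟩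
    · obtain ⟨x, h1, h2⟩ := h'.2.2 (s - c) (by linarith) (by linarith)
      exact ⟨x, by linarith [geodesicDist_triangle P a b x, h.1], by linarith⟩

theorem joinedWithin_dist_sq {P : Set (EuclideanSpace ℝ (Fin d))}
    {p q : EuclideanSpace ℝ (Fin d)} (hp : p ∈ P) (hq : q ∈ P) :
    JoinedWithin P p q (‖p - q‖ ^ 2) := by
  have half : ∀ p ∈ P, ∀ q ∈ P, ∀ u : ℝ, 0 ≤ u → u ≤ 1 / 2 →
      geodesicDist P p (p + u • (q - p)) ≤ 2 * u ^ 2 * ‖p - q‖ ^ 2 ∧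
      geodesicDist P q (p + u • (q - p)) ≤ ‖p - q‖ ^ 2 - 2 * u ^ 2 * ‖p - q‖ ^ 2 := by
    intro p hp q hq u hu0 hu1
    have h1 := geodesicDist_ray_le hp (q - p) le_rfl hu0
    -- From `q` the route goes to the midpoint at cost `‖p - q‖ ^ 2 / 2`, then back along the ray
    -- from `p`.
    have h2 := geodesicDist_ray_le hp (q - p) (a := 1 / 2) (by norm_num) hu0
    have h3 := geodesicDist_ray_le hq (p - q) (b := 1 / 2) le_rfl (by norm_num)
    have h4 : q + (1 / 2 : ℝ) • (p - q) = p + (1 / 2 : ℝ) • (q - p) := by module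
    have h5 := geodesicDist_triangle P q (p + (1 / 2 : ℝ) • (q - p)) (p + u • (q - p))
    rw [h4] at h3
    rw [norm_sub_rev q p] at h1 h2
    rw [zero_smul, add_zero] at h1 h3
    rw [abs_of_nonneg (by nlinarith)] at h1
    rw [abs_of_nonpos (by nlinarith)] at h2
    rw [abs_of_nonneg (by norm_num)] at h3
    constructor <;> linarith
  have main : ∀ p ∈ P, ∀ q ∈ P, ∀ s, 0 ≤ s → s ≤ ‖p - q‖ ^ 2 / 2 →
      ∃ x, geodesicDist P p x ≤ s ∧ geodesicDist P q x ≤ ‖p - q‖ ^ 2 - s := by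
    intro p hp q hq s hs hsc
    rcases (sq_nonneg ‖p - q‖).eq_or_lt with h0 | hpos
    · have hs0 : s = 0 := by linarith
      subst hs0
      have := half p hp q hq 0 le_rfl (by norm_num)
      exact ⟨_, by linarith [this.1], by linarith [this.2]⟩
    · have hle : s / (2 * ‖p - q‖ ^ 2) ≤ (1 / 2) ^ 2 := by
        rw [div_le_iff₀ (by positivity)]; linarith
      -- This parameter solves `2 * u ^ 2 * ‖p - q‖ ^ 2 = s`.
      have := half p hp q hq (√(s / (2 * ‖p - q‖ ^ 2))) (Real.sqrt_nonneg _)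
        (Real.sqrt_le_iff.2 ⟨by norm_num, hle⟩)
      rw [Real.sq_sqrt (by positivity)] at this
      have e : 2 * (s / (2 * ‖p - q‖ ^ 2)) * ‖p - q‖ ^ 2 = s := by
        generalize ‖p - q‖ ^ 2 = X at hpos ⊢
        field_simp
      rw [e] at this
      exact ⟨_, this⟩
  have le : ∀ p ∈ P, ∀ q ∈ P, geodesicDist P p q ≤ ‖p - q‖ ^ 2 := fun p hp q hq => by
    have := (half q hq p hp 0 le_rfl (by norm_num)).2
    rw [norm_sub_rev]
    simpa using this
  refine ⟨le p hp q hq, by rw [norm_sub_rev]; exact le q hq p hp, fun s hs hsc => ?_⟩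
  rcases le_total s (‖p - q‖ ^ 2 / 2) with h | h
  · exact main p hp q hq s hs h
  · obtain ⟨x, h1, h2⟩ := main q hq p hp (‖p - q‖ ^ 2 - s) (by linarith)
      (by rw [norm_sub_rev q p]; linarith)
    rw [norm_sub_rev q p] at h2
    exact ⟨x, by linarith, h1⟩

end NearestNeighbor

/-! ### Correctness and running-time bounds for programs -/

namespace RealRAM

/-- Started in `s`, the program `p` halts after at most `B` steps in a state that satisfies `Q`. -/
def Halts (p : Program) (s : State) (B : ℕ) (Q : State → Prop) : Prop :=
  ∃ t s', Runs p s t s' ∧ t ≤ B ∧ Q s'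

namespace Halts

variable {s : State} {Q : State → Prop}

theorem weaken {p : Program} {B B' : ℕ} (h : Halts p s B Q) (hB : B ≤ B') : Halts p s B' Q := by
  obtain ⟨t, s', hr, ht, hQ⟩ := h
  exact ⟨t, s', hr, ht.trans hB, hQ⟩

theorem imp {p : Program} {B : ℕ} {R : State → Prop} (h : Halts p s B R)
    (hR : ∀ s', R s' → Q s') : Halts p s B Q := by
  obtain ⟨t, s', hr, ht, hQ⟩ := h
  exact ⟨t, s', hr, ht, hR _ hQ⟩

/-- The postcondition of the first program is itself a halting statement, so a chain of such rules
executes a program symbolically. -/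
theorem seq {p q : Program} {B B' : ℕ} (h : Halts p s B fun s' => Halts q s' B' Q) :
    Halts (.seq p q) s (B + B') Q := by
  obtain ⟨t, s', hr, ht, t', s'', hr', ht', hQ⟩ := h
  exact ⟨t + t', s'', hr.seq hr', by omega, hQ⟩

theorem natConst {x c : ℕ} (h : Q { s with nat := Function.update s.nat x c }) :
    Halts (.natConst x c) s 1 Q := ⟨1, _, .natConst s x c, le_rfl, h⟩

theorem natAdd {x y z : ℕ}
    (h : Q { s with nat := Function.update s.nat x (s.nat y + s.nat z) }) :
    Halts (.natAdd x y z) s 1 Q := ⟨1, _, .natAdd s x y z, le_rfl, h⟩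

theorem natSub {x y z : ℕ}
    (h : Q { s with nat := Function.update s.nat x (s.nat y - s.nat z) }) :
    Halts (.natSub x y z) s 1 Q := ⟨1, _, .natSub s x y z, le_rfl, h⟩

theorem realConst {x : ℕ} {c : ℚ}
    (h : Q { s with real := Function.update s.real x (c : ℝ) }) :
    Halts (.realConst x c) s 1 Q := ⟨1, _, .realConst s x c, le_rfl, h⟩

theorem realAdd {x y z : ℕ}
    (h : Q { s with real := Function.update s.real x (s.real y + s.real z) }) :
    Halts (.realAdd x y z) s 1 Q := ⟨1, _, .realAdd s x y z, le_rfl, h⟩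

theorem realSub {x y z : ℕ}
    (h : Q { s with real := Function.update s.real x (s.real y - s.real z) }) :
    Halts (.realSub x y z) s 1 Q := ⟨1, _, .realSub s x y z, le_rfl, h⟩

theorem realMul {x y z : ℕ}
    (h : Q { s with real := Function.update s.real x (s.real y * s.real z) }) :
    Halts (.realMul x y z) s 1 Q := ⟨1, _, .realMul s x y z, le_rfl, h⟩

theorem load {x k a : ℕ}
    (h : Q { s with real := Function.update s.real x (s.mem k (s.nat a)) }) :
    Halts (.load x k a) s 1 Q := ⟨1, _, .load s x k a, le_rfl, h⟩

theorem store {k a x : ℕ}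
    (h : Q { s with mem := Function.update s.mem k
                              (Function.update (s.mem k) (s.nat a) (s.real x)) }) :
    Halts (.store k a x) s 1 Q := ⟨1, _, .store s k a x, le_rfl, h⟩

/-- Storing the smaller of two registers. -/
theorem ifReal_store {k a x y : ℕ}
    (h : Q { s with mem := Function.update s.mem k
                              (Function.update (s.mem k) (s.nat a) (min (s.real x) (s.real y))) }) :
    Halts (.ifReal x y (.store k a x) (.store k a y)) s 2 Q := by
  by_cases hlt : s.real x < s.real y
  · rw [min_eq_left hlt.le] at h
    exact ⟨2, _, .ifReal_true hlt (.store s k a x), le_rfl, h⟩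
  · rw [min_eq_right (not_lt.1 hlt)] at h
    exact ⟨2, _, .ifReal_false hlt (.store s k a y), le_rfl, h⟩

/-- A loop with counter `x` and bound `y`. -/
theorem whileNat {x y : ℕ} {p : Program} {N B : ℕ} (I : ℕ → State → Prop)
    (hreg : ∀ k s, I k s → s.nat x = k ∧ s.nat y = N)
    (hbody : ∀ k < N, ∀ s, I k s → Halts p s B (I (k + 1))) (h : I 0 s) :
    Halts (.whileNat x y p) s (N * (B + 1) + 1) (I N) := by
  -- Induction on the number `j` of rounds still to run.
  have key : ∀ j ≤ N, ∀ s, I (N - j) s → Halts (.whileNat x y p) s (j * (B + 1) + 1) (I N) := by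
    intro j
    induction j with
    | zero =>
      intro _ s hs
      have := hreg _ _ hs
      exact ⟨1, s, .whileNat_done (by omega), by omega, by simpa using hs⟩
    | succ j ih =>
      intro hj s hs
      have hr := hreg _ _ hs
      obtain ⟨t, s', hrun, ht, hI⟩ := hbody (N - (j + 1)) (by omega) s hs
      rw [show N - (j + 1) + 1 = N - j by omega] at hI
      obtain ⟨t', s'', hrun', ht', hI'⟩ := ih (by omega) s' hI
      exact ⟨t + t' + 1, s'', .whileNat_step (by omega) hrun hrun', by linarith, hI'⟩
  exact key N le_rfl s (by simpa using h)

end Halts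

theorem address_injective {n i j i' j' : ℕ} (hj : j < n) (hj' : j' < n)
    (h : i * n + j = i' * n + j') : i = i' ∧ j = j' := by
  have hn : 0 < n := by omega
  have h1 := congrArg (· / n) h
  have h2 := congrArg (· % n) h
  simp only [Nat.mul_add_mod_self_right, Nat.mod_eq_of_lt hj, Nat.mod_eq_of_lt hj'] at h2
  simp only [mul_comm _ n, Nat.mul_add_div hn, Nat.div_eq_of_lt hj, Nat.div_eq_of_lt hj'] at h1
  exact ⟨by simpa using h1, h2⟩

/-! ### Half the squared distances -/

/-- Half the squared distance of the points `i` and `j`, whose coordinates are in the array `X`. -/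
noncomputable def halfSqDist (d : ℕ) (X : ℕ → ℝ) (i j : ℕ) : ℝ :=
  (∑ k ∈ Finset.range d, (X (i * d + k) - X (j * d + k)) ^ 2) * (1 / 2)

/-- Adds one squared difference of coordinates. -/
def coordStep : Program :=
  -- Addresses are advanced by additions, as naturals cannot be multiplied: registers 7 and 8 point
  -- at the current coordinates of the points `i` and `j`.
  .seq (.load 1 0 7) <| .seq (.load 2 0 8) <| .seq (.realSub 1 1 2) <| .seq (.realMul 1 1 1) <|
  .seq (.realAdd 0 0 1) <| .seq (.natAdd 7 7 2) <| .seq (.natAdd 8 8 2) (.natAdd 6 6 2)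

/-- Computes one entry of the matrix of half the squared distances. -/
def distStep : Program :=
  .seq (.natConst 6 0) <| .seq (.realConst 0 0) <| .seq (.whileNat 6 1 coordStep) <|
  .seq (.realMul 0 0 3) <| .seq (.store 1 9 0) <| .seq (.natAdd 9 9 2) <|
  -- Register 7 is rewound to the start of point `i`, while 8 already stands at point `j + 1`.
  .seq (.natSub 7 7 1) (.natAdd 5 5 2)

/-- Computes one row of the matrix of half the squared distances. -/
def distRow : Program :=
  .seq (.natConst 5 0) <| .seq (.natConst 8 0) <| .seq (.whileNat 5 0 distStep) <|
  .seq (.natAdd 7 7 1) (.natAdd 4 4 2)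

/-- Computes the matrix of half the squared distances. -/
def distMatrix : Program :=
  .seq (.natConst 2 1) <| .seq (.realConst 3 (1 / 2)) (.whileNat 4 0 distRow)

/-- The registers that hold constants while the distances are computed. -/
structure DistFrame (n d : ℕ) (X : ℕ → ℝ) (s : State) : Prop where
  n0 : s.nat 0 = n
  n1 : s.nat 1 = d
  n2 : s.nat 2 = 1
  -- Registers 3, 10 and 11 stay zero for the next phase: 3 serves as the constant zero, 10 and 11
  -- as the initial `k` and `k * n`.
  n3 : s.nat 3 = 0
  n10 : s.nat 10 = 0
  n11 : s.nat 11 = 0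
  r3 : s.real 3 = 1 / 2
  m0 : s.mem 0 = X

/-- The entries with addresses below `a` have been computed. -/
def DistBelow (n d : ℕ) (X : ℕ → ℝ) (a : ℕ) (s : State) : Prop :=
  s.nat 9 = a ∧ ∀ i < n, ∀ j < n, i * n + j < a → s.mem 1 (i * n + j) = halfSqDist d X i j

theorem halts_coordStep {n d i j a : ℕ} {X : ℕ → ℝ} {s : State} (hf : DistFrame n d X s)
    (hb : DistBelow n d X a s) (h4 : s.nat 4 = i) (h5 : s.nat 5 = j) (h6 : s.nat 6 = 0)
    (h7 : s.nat 7 = i * d) (h8 : s.nat 8 = j * d) (h0 : s.real 0 = 0) :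
    Halts (.whileNat 6 1 coordStep) s (d * (8 + 1) + 1) fun s =>
      DistFrame n d X s ∧ DistBelow n d X a s ∧ s.nat 4 = i ∧ s.nat 5 = j ∧
        s.nat 7 = i * d + d ∧ s.nat 8 = j * d + d ∧
        s.real 0 = ∑ l ∈ Finset.range d, (X (i * d + l) - X (j * d + l)) ^ 2 := by
  refine (Halts.whileNat (N := d) (fun k s => DistFrame n d X s ∧ DistBelow n d X a s ∧
      s.nat 4 = i ∧ s.nat 5 = j ∧ s.nat 6 = k ∧ s.nat 7 = i * d + k ∧ s.nat 8 = j * d + k ∧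
      s.real 0 = ∑ l ∈ Finset.range k, (X (i * d + l) - X (j * d + l)) ^ 2)
    (fun k s h => ⟨h.2.2.2.2.1, h.1.n1⟩) ?_ ⟨hf, hb, h4, h5, h6, by simpa, by simpa, by simpa⟩).imp ?_
  · rintro k hk s ⟨⟨n0, n1, n2, n3, n10, n11, r3, m0⟩, ⟨h9, hm⟩, h4, h5, h6, h7, h8, h0⟩
    refine Halts.weaken (Halts.seq <| Halts.load <| Halts.seq <| Halts.load <| Halts.seq <|
      Halts.realSub <| Halts.seq <| Halts.realMul <| Halts.seq <| Halts.realAdd <| Halts.seq <|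
      Halts.natAdd <| Halts.seq <| Halts.natAdd <| Halts.natAdd ?_) (by norm_num)
    refine ⟨?_, ⟨?_, hm⟩, ?_⟩
    · constructor <;> simp [*]
    · simp [*]
    · simp [*, Finset.sum_range_succ, add_assoc, sq]
  · rintro s ⟨hf, hb, h4, h5, -, h7, h8, h0⟩
    exact ⟨hf, hb, h4, h5, h7, h8, h0⟩

theorem halts_distStep {n d i j : ℕ} {X : ℕ → ℝ} {s : State} (hj : j < n)
    (hf : DistFrame n d X s) (hb : DistBelow n d X (i * n + j) s) (h4 : s.nat 4 = i)
    (h5 : s.nat 5 = j) (h7 : s.nat 7 = i * d) (h8 : s.nat 8 = j * d) :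
    Halts distStep s (d * 9 + 8) fun s =>
      DistFrame n d X s ∧ DistBelow n d X (i * n + (j + 1)) s ∧ s.nat 4 = i ∧ s.nat 5 = j + 1 ∧
        s.nat 7 = i * d ∧ s.nat 8 = (j + 1) * d := by
  refine Halts.weaken (Halts.seq <| Halts.natConst <| Halts.seq <| Halts.realConst <|
    Halts.seq <| (halts_coordStep (n := n) (d := d) (i := i) (j := j) (a := i * n + j) (X := X)
      ?_ ⟨?_, ?_⟩ ?_ ?_ ?_ ?_ ?_ ?_).imp
    fun s' hs' => Halts.seq <| Halts.realMul <| Halts.seq <| Halts.store <| Halts.seq <|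
      Halts.natAdd <| Halts.seq <| Halts.natSub <| Halts.natAdd ?_) (by linarith)
  · obtain ⟨n0, n1, n2, n3, n10, n11, r3, m0⟩ := hf
    constructor <;> simp [*]
  · simpa [Function.update_apply] using hb.1
  · exact hb.2
  · simpa [Function.update_apply] using h4
  · simpa [Function.update_apply] using h5
  · simp
  · simpa [Function.update_apply] using h7
  · simpa [Function.update_apply] using h8
  · simp
  · obtain ⟨⟨n0, n1, n2, n3, n10, n11, r3, m0⟩, ⟨h9, hm⟩, h4, h5, h7, h8, h0⟩ := hs'
    refine ⟨?_, ⟨?_, ?_⟩, ?_⟩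
    · constructor <;> simp [*]
    · simp [*, add_assoc]
    · intro i' hi' j' hj' hlt
      rcases (show i' * n + j' < i * n + j ∨ i' * n + j' = i * n + j by omega) with h | h
      · simp [h9, h.ne, hm i' hi' j' hj' h]
      · obtain ⟨rfl, rfl⟩ := address_injective hj' hj h
        simp [h9, h0, r3, halfSqDist]
    · simp [*, add_mul]

theorem halts_distRow {n d i : ℕ} {X : ℕ → ℝ} {s : State}
    (hf : DistFrame n d X s) (hb : DistBelow n d X (i * n) s) (h4 : s.nat 4 = i)
    (h7 : s.nat 7 = i * d) :
    Halts distRow s (n * (d * 9 + 9) + 5) fun s =>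
      DistFrame n d X s ∧ DistBelow n d X ((i + 1) * n) s ∧ s.nat 4 = i + 1 ∧
        s.nat 7 = (i + 1) * d := by
  refine Halts.weaken (Halts.seq <| Halts.natConst <| Halts.seq <| Halts.natConst <|
    Halts.seq <| (Halts.whileNat (N := n) (B := d * 9 + 8)
      (fun j s => DistFrame n d X s ∧ DistBelow n d X (i * n + j) s ∧ s.nat 4 = i ∧ s.nat 5 = j ∧
        s.nat 7 = i * d ∧ s.nat 8 = j * d) (fun j s h => ⟨h.2.2.2.1, h.1.n0⟩)
      (fun j hj s h => halts_distStep hj h.1 h.2.1 h.2.2.1 h.2.2.2.1 h.2.2.2.2.1 h.2.2.2.2.2)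
      ⟨?_, ⟨?_, by simpa using hb.2⟩, ?_⟩).imp
    fun s' hs' => Halts.seq <| Halts.natAdd <| Halts.natAdd ?_) (by linarith)
  · obtain ⟨n0, n1, n2, n3, n10, n11, r3, m0⟩ := hf
    constructor <;> simp [*]
  · simpa [Function.update_apply] using hb.1
  · simp [*]
  · obtain ⟨⟨n0, n1, n2, n3, n10, n11, r3, m0⟩, ⟨h9, hm⟩, h4, h5, h7, h8⟩ := hs'
    refine ⟨?_, ⟨?_, ?_⟩, ?_⟩
    · constructor <;> simp [*]
    · simp [*, add_mul]
    · simpa [add_mul] using hm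
    · simp [*, add_mul]

theorem halts_distMatrix {n d : ℕ} {s : State} (h0 : s.nat 0 = n) (h1 : s.nat 1 = d)
    (hz : ∀ x, 2 ≤ x → s.nat x = 0) :
    Halts distMatrix s (n * (n * (d * 9 + 9) + 6) + 3) fun s' =>
      s'.nat 0 = n ∧ s'.nat 2 = 1 ∧ s'.nat 3 = 0 ∧ s'.nat 10 = 0 ∧ s'.nat 11 = 0 ∧
        ∀ i < n, ∀ j < n, s'.mem 1 (i * n + j) = halfSqDist d (s.mem 0) i j := by
  refine Halts.weaken (Halts.seq <| Halts.natConst <| Halts.seq <| Halts.realConst <|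
    (Halts.whileNat (N := n) (B := n * (d * 9 + 9) + 5)
      (fun i s' => DistFrame n d (s.mem 0) s' ∧ DistBelow n d (s.mem 0) (i * n) s' ∧
        s'.nat 4 = i ∧ s'.nat 7 = i * d) (fun j s h => ⟨h.2.2.1, h.1.n0⟩)
      (fun j hj s h => halts_distRow h.1 h.2.1 h.2.2.1 h.2.2.2)
      ⟨?_, ⟨?_, by simp⟩, ?_⟩).imp
    fun s' hs' => ?_) (by linarith)
  · constructor <;> simp [*]
  · simp [*]
  · simp [*]
  · obtain ⟨hf, hb, -, -⟩ := hs'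
    refine ⟨hf.n0, hf.n2, hf.n3, hf.n10, hf.n11, fun i hi j hj => hb.2 i hi j hj ?_⟩
    calc i * n + j < i * n + n := by omega
      _ = (i + 1) * n := by ring
      _ ≤ n * n := Nat.mul_le_mul_right n hi

/-! ### All shortest paths -/

/-- One relaxation of the matrix `M` with intermediate vertex `k`. -/
noncomputable def relax (k : ℕ) (M : ℕ → ℕ → ℝ) (i j : ℕ) : ℝ :=
  min (M i k + M k j) (M i j)

/-- `M` is bounded by `W`, has only entries with the property `Q`, and satisfies the triangle
inequality for intermediate vertices below `k`. -/
structure ShortUpTo (n k : ℕ) (W : ℕ → ℕ → ℝ) (Q : ℕ → ℕ → ℝ → Prop) (M : ℕ → ℕ → ℝ) : Prop where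
  diag : ∀ i < n, M i i = 0
  nonneg : ∀ i < n, ∀ j < n, 0 ≤ M i j
  le : ∀ i < n, ∀ j < n, M i j ≤ W i j
  triangle : ∀ m < k, ∀ i < n, ∀ j < n, M i j ≤ M i m + M m j
  mem : ∀ i < n, ∀ j < n, Q i j (M i j)

/-- If both legs through `m` detour via `k`, the loop from `k` to `m` and back has nonnegative
weight and can be dropped. The predicate `Q`, closed under concatenation, records that entries are
realized by chains, so paths in the graph need not be formalized. -/
theorem ShortUpTo.relax {n k : ℕ} {W : ℕ → ℕ → ℝ} {Q : ℕ → ℕ → ℝ → Prop} {M : ℕ → ℕ → ℝ}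
    (hQ : ∀ i < n, ∀ j < n, ∀ l < n, ∀ c c', Q i j c → Q j l c' → Q i l (c + c')) (hk : k < n)
    (h : ShortUpTo n k W Q M) : ShortUpTo n (k + 1) W Q (relax k M) where
  diag i hi := by
    rw [RealRAM.relax, h.diag i hi]
    exact min_eq_right (add_nonneg (h.nonneg i hi k hk) (h.nonneg k hk i hi))
  nonneg i hi j hj :=
    le_min (add_nonneg (h.nonneg i hi k hk) (h.nonneg k hk j hj)) (h.nonneg i hi j hj)
  le i hi j hj := (min_le_right _ _).trans (h.le i hi j hj)
  mem i hi j hj := by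
    rw [RealRAM.relax]
    rcases min_choice (M i k + M k j) (M i j) with e | e <;> rw [e]
    · exact hQ i hi k hk j hj _ _ (h.mem i hi k hk) (h.mem k hk j hj)
    · exact h.mem i hi j hj
  triangle m hm i hi j hj := by
    have hd := h.diag k hk
    rcases (show m < k ∨ m = k by omega) with hm | rfl
    · have hmn := hm.trans hk
      have h1 := h.triangle m hm i hi j hj
      have h2 := h.triangle m hm i hi k hk
      have h3 := h.triangle m hm k hk j hj
      have h4 := h.nonneg k hk m hmn
      have h5 := h.nonneg m hmn k hk
      simp only [RealRAM.relax]
      rcases min_choice (M i k + M k m) (M i m) with e | e <;>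
        rcases min_choice (M m k + M k j) (M m j) with e' | e' <;> rw [e, e', min_le_iff]
      · left; linarith
      · left; linarith
      · left; linarith
      · right; exact h1
    · simp [RealRAM.relax, hd]

/-- Relaxes one entry. -/
def relaxStep : Program :=
  .seq (.load 1 1 14) <| .seq (.load 2 1 16) <| .seq (.realAdd 1 1 2) <| .seq (.load 2 1 13) <|
  .seq (.ifReal 1 2 (.store 1 13 1) (.store 1 13 2)) <| .seq (.natAdd 13 13 2) <|
  .seq (.natAdd 16 16 2) (.natAdd 15 15 2)

/-- Relaxes one row. -/
def relaxRow : Program :=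
  -- Adding the zero register 3 copies `k * n` from register 11.
  .seq (.natConst 15 0) <| .seq (.natAdd 16 11 3) <| .seq (.whileNat 15 0 relaxStep) <|
  .seq (.natAdd 14 14 0) (.natAdd 12 12 2)

/-- Relaxes all entries with one intermediate vertex. -/
def relaxMatrix : Program :=
  .seq (.natConst 12 0) <| .seq (.natConst 13 0) <| .seq (.natAdd 14 10 3) <|
  .seq (.whileNat 12 0 relaxRow) <| .seq (.natAdd 11 11 0) (.natAdd 10 10 2)

/-- The Floyd-Warshall algorithm, in place. -/
def floydWarshall : Program := .whileNat 10 0 relaxMatrix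

/-- The registers that are fixed during the relaxation with intermediate vertex `k`. -/
structure RelaxFrame (n k : ℕ) (s : State) : Prop where
  n0 : s.nat 0 = n
  n2 : s.nat 2 = 1
  n3 : s.nat 3 = 0
  n10 : s.nat 10 = k
  n11 : s.nat 11 = k * n

/-- The entries with addresses below `a` have been relaxed. -/
def RelaxedBelow (n k : ℕ) (M : ℕ → ℕ → ℝ) (a : ℕ) (s : State) : Prop :=
  s.nat 13 = a ∧ ∀ i < n, ∀ j < n,
    s.mem 1 (i * n + j) = if i * n + j < a then relax k M i j else M i j

theorem halts_relaxStep {n k i j : ℕ} {M : ℕ → ℕ → ℝ} {s : State} (hk : k < n) (hi : i < n)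
    (hj : j < n) (hd : M k k = 0) (hf : RelaxFrame n k s) (hb : RelaxedBelow n k M (i * n + j) s)
    (h12 : s.nat 12 = i) (h14 : s.nat 14 = i * n + k) (h15 : s.nat 15 = j)
    (h16 : s.nat 16 = k * n + j) :
    Halts relaxStep s 9 fun s =>
      RelaxFrame n k s ∧ RelaxedBelow n k M (i * n + (j + 1)) s ∧ s.nat 12 = i ∧
        s.nat 14 = i * n + k ∧ s.nat 15 = j + 1 ∧ s.nat 16 = k * n + (j + 1) := by
  obtain ⟨n0, n2, n3, n10, n11⟩ := hf
  obtain ⟨h13, hm⟩ := hb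
  -- Working in place is harmless: since `M k k = 0`, relaxation via `k` leaves row `k` and column
  -- `k` unchanged, whether or not these cells were already visited.
  have hik : s.mem 1 (i * n + k) = M i k := by
    rw [hm i hi k hk]; simp [relax, hd]
  have hkj : s.mem 1 (k * n + j) = M k j := by
    rw [hm k hk j hj]; simp [relax, hd]
  have hij : s.mem 1 (i * n + j) = M i j := by
    rw [hm i hi j hj, if_neg (lt_irrefl _)]
  refine Halts.weaken (Halts.seq <| Halts.load <| Halts.seq <| Halts.load <| Halts.seq <|
    Halts.realAdd <| Halts.seq <| Halts.load <| Halts.seq <| Halts.ifReal_store <| Halts.seq <|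
    Halts.natAdd <| Halts.seq <| Halts.natAdd <| Halts.natAdd ?_) (by norm_num)
  refine ⟨?_, ⟨?_, ?_⟩, ?_⟩
  · constructor <;> simp [*]
  · simp [*, add_assoc]
  · intro i' hi' j' hj'
    by_cases h : i' * n + j' = i * n + j
    · obtain ⟨rfl, rfl⟩ := address_injective hj' hj h
      simp [h13, h14, h16, hik, hkj, hij, relax]
    · simp [h13, h, hm i' hi' j' hj',
        show i' * n + j' < i * n + (j + 1) ↔ i' * n + j' < i * n + j by omega]
  · simp [*, add_assoc]

theorem halts_relaxRow {n k i : ℕ} {M : ℕ → ℕ → ℝ} {s : State} (hk : k < n) (hi : i < n)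
    (hd : M k k = 0) (hf : RelaxFrame n k s) (hb : RelaxedBelow n k M (i * n) s)
    (h12 : s.nat 12 = i) (h14 : s.nat 14 = i * n + k) :
    Halts relaxRow s (n * 10 + 5) fun s =>
      RelaxFrame n k s ∧ RelaxedBelow n k M ((i + 1) * n) s ∧ s.nat 12 = i + 1 ∧
        s.nat 14 = (i + 1) * n + k := by
  refine Halts.weaken (Halts.seq <| Halts.natConst <| Halts.seq <| Halts.natAdd <|
    Halts.seq <| (Halts.whileNat (N := n) (B := 9)
      (fun j s => RelaxFrame n k s ∧ RelaxedBelow n k M (i * n + j) s ∧ s.nat 12 = i ∧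
        s.nat 14 = i * n + k ∧ s.nat 15 = j ∧ s.nat 16 = k * n + j)
      (fun j s h => ⟨h.2.2.2.2.1, h.1.n0⟩)
      (fun j hj s h => halts_relaxStep hk hi hj hd h.1 h.2.1 h.2.2.1 h.2.2.2.1 h.2.2.2.2.1
        h.2.2.2.2.2)
      ⟨?_, ⟨?_, by simpa using hb.2⟩, ?_⟩).imp
    fun s' hs' => Halts.seq <| Halts.natAdd <| Halts.natAdd ?_) (by linarith)
  · obtain ⟨n0, n2, n3, n10, n11⟩ := hf
    constructor <;> simp [*]
  · simpa using hb.1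
  · simp [h12, h14, hf.n11, hf.n3]
  · obtain ⟨⟨n0, n2, n3, n10, n11⟩, ⟨h13, hm⟩, h12, h14, h15, h16⟩ := hs'
    refine ⟨?_, ⟨?_, ?_⟩, ?_⟩
    · constructor <;> simp [*]
    · simp [*, add_mul]
    · simpa [add_mul] using hm
    · simp [*]; ring

theorem halts_relaxMatrix {n k : ℕ} {M : ℕ → ℕ → ℝ} {s : State} (hk : k < n)
    (hd : M k k = 0) (hf : RelaxFrame n k s)
    (hM : ∀ i < n, ∀ j < n, s.mem 1 (i * n + j) = M i j) :
    Halts relaxMatrix s (n * (n * 10 + 6) + 6) fun s =>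
      RelaxFrame n (k + 1) s ∧ ∀ i < n, ∀ j < n, s.mem 1 (i * n + j) = relax k M i j := by
  refine Halts.weaken (Halts.seq <| Halts.natConst <| Halts.seq <| Halts.natConst <|
    Halts.seq <| Halts.natAdd <|
    Halts.seq <| (Halts.whileNat (N := n) (B := n * 10 + 5)
      (fun i s => RelaxFrame n k s ∧ RelaxedBelow n k M (i * n) s ∧ s.nat 12 = i ∧
        s.nat 14 = i * n + k)
      (fun j s h => ⟨h.2.2.1, h.1.n0⟩)
      (fun i hi s h => halts_relaxRow hk hi hd h.1 h.2.1 h.2.2.1 h.2.2.2)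
      ⟨?_, ⟨?_, by simpa using hM⟩, ?_⟩).imp
    fun s' hs' => Halts.seq <| Halts.natAdd <| Halts.natAdd ?_) (by linarith)
  · obtain ⟨n0, n2, n3, n10, n11⟩ := hf
    constructor <;> simp [*]
  · simp
  · simp [hf.n10, hf.n3]
  · obtain ⟨⟨n0, n2, n3, n10, n11⟩, ⟨-, hm⟩, -, -⟩ := hs'
    refine ⟨?_, fun i hi j hj => ?_⟩
    · constructor <;> simp [*, add_mul]
    · refine (hm i hi j hj).trans (if_pos ?_)
      calc i * n + j < i * n + n := by omega
        _ = (i + 1) * n := by ring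
        _ ≤ n * n := Nat.mul_le_mul_right n hi

theorem halts_floydWarshall {n : ℕ} {W : ℕ → ℕ → ℝ} {Q : ℕ → ℕ → ℝ → Prop} {s : State}
    (hQ : ∀ i < n, ∀ j < n, ∀ l < n, ∀ c c', Q i j c → Q j l c' → Q i l (c + c'))
    (hW : ShortUpTo n 0 W Q W) (hf : RelaxFrame n 0 s)
    (hm : ∀ i < n, ∀ j < n, s.mem 1 (i * n + j) = W i j) :
    Halts floydWarshall s (n * (n * (n * 10 + 6) + 7) + 1) fun s =>
      ∃ M, ShortUpTo n n W Q M ∧ ∀ i < n, ∀ j < n, s.mem 1 (i * n + j) = M i j := by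
  refine (Halts.whileNat (N := n) (B := n * (n * 10 + 6) + 6)
    (fun k s => RelaxFrame n k s ∧ ∃ M, ShortUpTo n k W Q M ∧
      ∀ i < n, ∀ j < n, s.mem 1 (i * n + j) = M i j)
    (fun k s h => ⟨h.1.n10, h.1.n0⟩) ?_ ⟨hf, W, hW, hm⟩).imp fun s h => h.2
  rintro k hk s ⟨hf, M, hM, hs⟩
  exact (halts_relaxMatrix hk (hM.diag k hk) hf hs).imp fun s h =>
    ⟨h.1, relax k M, hM.relax hQ hk, h.2⟩

theorem halfSqDist_input {n d : ℕ} (p : Fin n → EuclideanSpace ℝ (Fin d)) (i j : Fin n) :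
    halfSqDist d ((input p).mem 0) i j = ‖p i - p j‖ ^ 2 / 2 := by
  have h : ∀ (i : Fin n) (k : Fin d), (input p).mem 0 (i * d + k) = p i k := by
    intro i k
    have hlt : (i : ℕ) * d + k < n * d := by
      calc (i : ℕ) * d + k < i * d + d := by omega
        _ = (i + 1) * d := by ring
        _ ≤ n * d := Nat.mul_le_mul_right d i.2
    have e : (⟨i * d + k, hlt⟩ : Fin (n * d)) = finProdFinEquiv (i, k) := by
      ext; simp [finProdFinEquiv, add_comm, mul_comm]
    simp only [input]
    rw [dif_pos ⟨trivial, hlt⟩, e, Equiv.symm_apply_apply]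
  rw [halfSqDist, Finset.sum_range, EuclideanSpace.norm_sq_eq]
  simp [h]
  ring

end RealRAM

/-! ### From the shortest-path matrix to the Čech edges -/

namespace NearestNeighbor

theorem mem_cechEdges_iff {n d : ℕ} {p : Fin n → EuclideanSpace ℝ (Fin d)}
    (hp : Function.Injective p) {β : Fin n → Fin n → ℝ} {α : ℝ}
    (hβ : ∀ i j, β i j ≤ α ↔ (geodesicBall (Set.range p) (p i) α ∩
      geodesicBall (Set.range p) (p j) α).Nonempty) :
    cechEdges (Set.range p) α = {σ | ∃ i j : Fin n, i < j ∧ σ = {p i, p j} ∧ β i j ≤ α} := by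
  ext σ
  constructor
  · rintro ⟨⟨-, hsub, z, hz⟩, hcard⟩
    obtain ⟨x, y, hxy, rfl⟩ := Finset.card_eq_two.1 hcard
    obtain ⟨i, rfl⟩ := hsub (show x ∈ _ by simp)
    obtain ⟨j, rfl⟩ := hsub (show y ∈ _ by simp)
    simp only [Set.mem_iInter] at hz
    have hi := hz (p i) (by simp)
    have hj := hz (p j) (by simp)
    rcases lt_trichotomy i j with h | rfl | h
    · exact ⟨i, j, h, rfl, (hβ i j).2 ⟨z, hi, hj⟩⟩
    · exact absurd rfl hxy
    · exact ⟨j, i, h, Finset.pair_comm _ _, (hβ j i).2 ⟨z, hj, hi⟩⟩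
  · rintro ⟨i, j, hij, rfl, h⟩
    obtain ⟨z, hi, hj⟩ := (hβ i j).1 h
    refine ⟨⟨by simp, ?_, z, ?_⟩, Finset.card_pair (hp.ne hij.ne)⟩
    · intro x hx
      rcases (by simpa using hx : x = p i ∨ x = p j) with rfl | rfl <;> simp
    · simp only [Set.mem_iInter]
      intro x hx
      rcases (by simpa using hx : x = p i ∨ x = p j) with rfl | rfl
      · exact hi
      · exact hj

end NearestNeighbor

open NearestNeighbor RealRAM in
/-- The shortest-path matrix for half the squared distances decides which balls meet. -/
theorem RealRAM.ShortUpTo.le_iff {n d : ℕ} {p : Fin n → EuclideanSpace ℝ (Fin d)}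
    (hp : Function.Injective p) {W M : ℕ → ℕ → ℝ}
    (hW : ∀ i j : Fin n, W i j = ‖p i - p j‖ ^ 2 / 2)
    (hM : ShortUpTo n n W (fun i j c => ∀ (hi : i < n) (hj : j < n),
      JoinedWithin (Set.range p) (p ⟨i, hi⟩) (p ⟨j, hj⟩) (2 * c)) M)
    {α : ℝ} (i j : Fin n) : M i j ≤ α ↔
      (geodesicBall (Set.range p) (p i) α ∩ geodesicBall (Set.range p) (p j) α).Nonempty := by
  constructor
  · intro h
    have h0 := hM.nonneg i i.2 j j.2
    -- The chain has total cost `2 * M i j`; this is its point halfway in cost.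
    obtain ⟨x, h1, h2⟩ := (hM.mem i i.2 j j.2 i.2 j.2).2.2 (M i j) h0 (by linarith)
    exact ⟨x, h1.trans h, h2.trans (by linarith)⟩
  · rintro ⟨x, h1, h2⟩
    have key := sub_le_geodesicDist_add_geodesicDist (P := Set.range p) (Set.finite_range p)
      -- The potential is the row of `i` in the unhalved distances; its values off `P` are
      -- irrelevant.
      (D := Function.extend p (fun j => 2 * M i j) 0) ?_
      (Set.mem_range_self i) (Set.mem_range_self j) x
    · rw [hp.extend_apply, hp.extend_apply, hM.diag i i.2] at key
      simp only [geodesicBall, Set.mem_ofPred_eq] at h1 h2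
      linarith
    · rintro _ ⟨a, rfl⟩ _ ⟨b, rfl⟩
      rw [hp.extend_apply, hp.extend_apply, norm_sub_rev]
      have h3 := hM.triangle b b.2 i i.2 a a.2
      have h4 := hM.le b b.2 a a.2
      rw [hW] at h4
      linarith

/-- The running time of the distance computation followed by the Floyd-Warshall algorithm. -/
noncomputable def stepBound : Polynomial ℕ :=
  (.X * (.X * (.X * 9 + 9) + 6) + 3) + (.X * (.X * (.X * 10 + 6) + 7) + 1)

theorem le_stepBound_eval (n d : ℕ) :
    (n * (n * (d * 9 + 9) + 6) + 3) + (n * (n * (n * 10 + 6) + 7) + 1)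
      ≤ stepBound.eval (n + d) := by
  have hn : n ≤ n + d := Nat.le_add_right _ _
  have hd : d ≤ n + d := Nat.le_add_left _ _
  simp only [stepBound, Polynomial.eval_add, Polynomial.eval_mul, Polynomial.eval_X,
    Polynomial.eval_ofNat, Polynomial.eval_one]
  generalize n + d = N at hn hd
  gcongr

theorem mainTheorem7 :
    ∃ (prog : RealRAM.Program) (T : Polynomial ℕ),
      ∀ (d n : ℕ) (p : Fin n → EuclideanSpace ℝ (Fin d)), Function.Injective p →
        ∃ (t : ℕ) (s : RealRAM.State),
          RealRAM.Runs prog (RealRAM.input p) t s ∧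
          t ≤ T.eval (n + d) ∧
          ∀ α : ℝ, 0 ≤ α →
            NearestNeighbor.cechEdges (Set.range p) α =
              {σ | ∃ i j : Fin n, i < j ∧ σ = {p i, p j} ∧ RealRAM.output s n i j ≤ α} := by
  refine ⟨.seq RealRAM.distMatrix RealRAM.floydWarshall, stepBound, fun d n p hp => ?_⟩
  set W := RealRAM.halfSqDist d ((RealRAM.input p).mem 0)
  have hW : ∀ i j : Fin n, W i j = ‖p i - p j‖ ^ 2 / 2 := RealRAM.halfSqDist_input p
  -- The factor `2` undoes the halving of the weights.
  set Q : ℕ → ℕ → ℝ → Prop := fun i j c => ∀ (hi : i < n) (hj : j < n),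
    NearestNeighbor.JoinedWithin (Set.range p) (p ⟨i, hi⟩) (p ⟨j, hj⟩) (2 * c)
  have hQ : ∀ i < n, ∀ j < n, ∀ l < n, ∀ c c', Q i j c → Q j l c' → Q i l (c + c') := by
    intro i _ j hj l _ c c' h h' hi hl
    rw [mul_add]
    exact (h hi hj).trans (h' hj hl)
  have hWQ : RealRAM.ShortUpTo n 0 W Q W :=
    { diag := fun i hi => by rw [hW ⟨i, hi⟩ ⟨i, hi⟩]; simp
      nonneg := fun i hi j hj => by rw [hW ⟨i, hi⟩ ⟨j, hj⟩]; positivity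
      le := fun i _ j _ => le_rfl
      triangle := fun m hm => absurd hm (Nat.not_lt_zero m)
      mem := fun i hi j hj _ _ => by
        rw [hW ⟨i, hi⟩ ⟨j, hj⟩, mul_div_cancel₀ _ two_ne_zero]
        exact NearestNeighbor.joinedWithin_dist_sq (Set.mem_range_self _) (Set.mem_range_self _) }
  have run := RealRAM.Halts.seq <| (RealRAM.halts_distMatrix (n := n) (d := d)
    (s := RealRAM.input p) rfl rfl (fun x hx => by
      simp [RealRAM.input, show x ≠ 0 by omega, show x ≠ 1 by omega])).imp
    fun s ⟨h0, h2, h3, h10, h11, hm⟩ => RealRAM.halts_floydWarshall hQ hWQ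
      ⟨h0, h2, h3, h10, by simpa using h11⟩ hm
  obtain ⟨t, s, hrun, ht, M, hM, hs⟩ := run
  refine ⟨t, s, hrun, ht.trans (le_stepBound_eval n d), fun α _ => ?_⟩
  refine NearestNeighbor.mem_cechEdges_iff hp fun i j => ?_
  rw [RealRAM.output, hs i i.2 j j.2]
  exact hM.le_iff hp hW i j
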